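/- For integers $n\ge 0$ let $D_n=\sum_{k=0}^{n}\binom nk^2 2^k$ be the $n$-th central Delannoy number, and let $C_n=\frac1{n+1}\binom{2n}{n}$ be the $n$-th Catalan number. For integers $n\ge 1$ let $s_n=\sum_{k=1}^{n}\frac1n\binom nk\binom n{k-1}2^{k-1}$ be the $n$-th little Schröder number, and for $1\le k\le n$ put $w(n,k)=\frac1k\binom{n-1}{k-1}\binom{n+k}{k-1}$. For every integer $n\ge 1$, $$\frac1n\sum_{k=0}^{n-1}D_k\,s_{k+1}=\sum_{k=1}^{n}w(n,k)\,C_{k-1}\,2^{k-1},$$ and this common value is an odd integer. Moreover, for every odd prime $p$, $$\sum_{k=0}^{p-1}D_k\,s_{k+1}\equiv 2p^2\bigl(1-3q_p(2)\bigr)\pmod{p^3},$$ where $q_p(2)=(2^{p-1}-1)/p$ is the Fermat quotient and both sides are integers. -/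

import Mathlib

namespace DelannoySchroder

/-- The Delannoy number `D_{m,n} = ∑_{k ≥ 0} C(m,k) C(n,k) 2^k`. All terms with `k > m` vanish. -/
def delannoy (m n : ℕ) : ℕ :=
  ∑ k ∈ Finset.range (m + 1), m.choose k * n.choose k * 2 ^ k

/-- The central Delannoy number `D_n = D_{n,n}`. -/
def centralDelannoy (n : ℕ) : ℕ := delannoy n n

/-- The Narayana number `N(n,k) = (1/n) C(n,k) C(n,k-1)` for `1 ≤ k ≤ n`, as a rational number. -/
def narayana (n k : ℕ) : ℚ :=
  1 / (n : ℚ) * (n.choose k : ℚ) * (n.choose (k - 1) : ℚ)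

/-- The little Schröder number `s_n = ∑_{k=1}^n N(n,k) 2^(k-1)` for `n ≥ 1`, so that
`s_1, s_2, s_3, s_4, … = 1, 3, 11, 45, …`. -/
def littleSchroder (n : ℕ) : ℚ :=
  ∑ k ∈ Finset.Icc 1 n, narayana n k * 2 ^ (k - 1)

/-- The number `w(n,k) = (1/k) C(n-1,k-1) C(n+k,k-1)` for `1 ≤ k ≤ n`, as a rational number. -/
def w (n k : ℕ) : ℚ :=
  1 / (k : ℚ) * ((n - 1).choose (k - 1) : ℚ) * ((n + k).choose (k - 1) : ℚ)

/-- The Fermat quotient `q_p(z) = (z^(p-1) - 1) / p`, as a rational number. It is an integer when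
`p` is a prime that does not divide `z`. -/
def fermatQuotient (p : ℕ) (z : ℤ) : ℚ :=
  ((z : ℚ) ^ (p - 1) - 1) / (p : ℚ)

end DelannoySchroder

namespace DelannoySchroder

open Finset

/-! Write `D n` for the central Delannoy and `s n` for the little Schröder numbers. Since `4 (n+2) s
(n+1) = 3 D (n+1) - D n`, each summand `D n * s (n+1)` is a combination of `D n * D (n+1)` and `D n
^ 2`. Both have single-sum closed forms with coefficients `C(n,k) C(n+k,k) C(2k,k) 2^k`
(`centralDelannoy_products`), and the combination telescopes (`partialSum_succ_sub`), which gives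
`n` times the weighted Catalan sum. The weights `w` are integers and every term after the first is
even, hence the parity.

For an odd prime `p` it remains to find the Catalan sum `W` (`wSum (p-1)`) modulo `p^2`. There
`(p+1) w(p,j+1)` is `(-1)^j + C(p,j+1)` for `j < p-1`, so `(p+1) W` splits into three pieces: the
sum of `C_j (-2)^j`, known from a closed form and `C(2p,k) ≡ 2 C(p,k)` (`sum_catalan_prime`); the
sum of `C(p,j+1) C_j 2^j`, which is `p` times a truncated logarithm modulo `p`
(`sum_chooseQuot_mul_catalan`); and the last term, governed by `catalan_prime_pred`. `wSum_modEq`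
adds them up. -/

theorem sum_Icc_one_eq_sum_range {M : Type*} [AddCommMonoid M] (f : ℕ → M) (n : ℕ) :
    ∑ k ∈ Icc 1 n, f k = ∑ k ∈ range n, f (k + 1) := by
  induction n with
  | zero => simp
  | succ n ih => rw [Finset.sum_Icc_succ_top (by omega), ih, Finset.sum_range_succ]

/-! ### Recurrences for Delannoy and Schröder numbers. -/

/-- The sum `∑ C(n,k) C(n,k+1) 2^k`, which equals `n` times the little Schröder number. -/
def offDelannoy (n : ℕ) : ℕ :=
  ∑ k ∈ range (n + 1), n.choose k * n.choose (k + 1) * 2 ^ k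

theorem centralDelannoy_succ (n : ℕ) :
    centralDelannoy (n + 1) = 3 * centralDelannoy n + 4 * offDelannoy n := by
  have h : centralDelannoy n =
      ∑ k ∈ range (n + 1), n.choose (k + 1) * n.choose (k + 1) * 2 ^ (k + 1) + 1 := by
    have := Finset.sum_range_succ' (fun k => n.choose k * n.choose k * 2 ^ k) (n + 1)
    rw [Finset.sum_range_succ] at this
    simpa [centralDelannoy, delannoy] using this
  have h1 : centralDelannoy (n + 1) =
      ∑ k ∈ range (n + 1), (n + 1).choose (k + 1) * (n + 1).choose (k + 1) * 2 ^ (k + 1) + 1 := by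
    simp [centralDelannoy, delannoy, Finset.sum_range_succ']
  have h2 : ∑ k ∈ range (n + 1), (n + 1).choose (k + 1) * (n + 1).choose (k + 1) * 2 ^ (k + 1) =
      2 * centralDelannoy n + 4 * offDelannoy n +
      ∑ k ∈ range (n + 1), n.choose (k + 1) * n.choose (k + 1) * 2 ^ (k + 1) := by
    rw [centralDelannoy, delannoy, offDelannoy, mul_sum, mul_sum, ← sum_add_distrib,
      ← sum_add_distrib]
    refine sum_congr rfl fun k _ => ?_
    rw [Nat.choose_succ_succ' n k]
    ring
  omega

theorem succ_mul_offDelannoy_succ (n : ℕ) :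
    (n + 2) * offDelannoy (n + 1) = (n + 1) * (2 * centralDelannoy n + 3 * offDelannoy n) := by
  have h1 : (n + 2) * offDelannoy (n + 1) = (n + 1) * ∑ k ∈ range (n + 2),
      n.choose k * ((n + 1).choose k + (n + 1).choose (k + 1)) * 2 ^ k := by
    rw [offDelannoy, mul_sum, mul_sum]
    refine sum_congr rfl fun k hk => ?_
    have hk' : k ≤ n + 1 := by simpa [Nat.lt_succ_iff] using hk
    have e1 := Nat.add_one_mul_choose_eq n k
    have e2 := Nat.choose_mul_succ_eq n k
    obtain ⟨d, hd⟩ := Nat.exists_eq_add_of_le hk'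
    have e3 : n + 1 - k = d := by omega
    rw [e3] at e2
    have e4 : n + 2 = (k + 1) + d := by omega
    rw [e4]
    linear_combination ((n + 1).choose k * 2 ^ k) * e1.symm +
      ((n + 1).choose (k + 1) * 2 ^ k) * e2.symm
  have h2 : ∑ k ∈ range (n + 2), n.choose k * ((n + 1).choose k + (n + 1).choose (k + 1)) * 2 ^ k =
      ∑ k ∈ range (n + 1), n.choose k * (n + 1).choose k * 2 ^ k +
      ∑ k ∈ range (n + 1), n.choose k * (n + 1).choose (k + 1) * 2 ^ k := by
    rw [Finset.sum_range_succ, ← sum_add_distrib]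
    simp only [Nat.choose_succ_self, zero_mul, add_zero]
    exact sum_congr rfl fun k _ => by ring
  have h3 : ∑ k ∈ range (n + 1), n.choose k * (n + 1).choose (k + 1) * 2 ^ k =
      centralDelannoy n + offDelannoy n := by
    rw [centralDelannoy, delannoy, offDelannoy, ← sum_add_distrib]
    refine sum_congr rfl fun k _ => ?_
    rw [Nat.choose_succ_succ' n k]
    ring
  have h4 : ∑ k ∈ range (n + 1), n.choose k * (n + 1).choose k * 2 ^ k =
      centralDelannoy n + 2 * offDelannoy n := by
    have h5 : offDelannoy n = ∑ k ∈ range n, n.choose k * n.choose (k + 1) * 2 ^ k := by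
      simp [offDelannoy, Finset.sum_range_succ]
    rw [h5, centralDelannoy, delannoy, Finset.sum_range_succ', Finset.sum_range_succ', mul_sum,
      add_right_comm, ← sum_add_distrib]
    simp only [Nat.choose_zero_right]
    congr 1
    refine sum_congr rfl fun k _ => ?_
    rw [Nat.choose_succ_succ' n k]
    ring
  rw [h1, h2, h3, h4]
  ring

theorem littleSchroder_succ (n : ℕ) :
    littleSchroder (n + 1) = (offDelannoy (n + 1) : ℚ) / (n + 1) := by
  have h : offDelannoy (n + 1) =
      ∑ k ∈ range (n + 1), (n + 1).choose k * (n + 1).choose (k + 1) * 2 ^ k := by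
    simp [offDelannoy, Finset.sum_range_succ _ (n + 1)]
  rw [littleSchroder, sum_Icc_one_eq_sum_range, h]
  push_cast
  rw [Finset.sum_div]
  simp only [narayana, Nat.add_sub_cancel, Nat.cast_add, Nat.cast_one]
  exact sum_congr rfl fun k _ => by ring

theorem littleSchroder_succ_mul (n : ℕ) :
    4 * ((n : ℚ) + 2) * littleSchroder (n + 1) =
      3 * (centralDelannoy (n + 1) : ℚ) - centralDelannoy n := by
  have h := succ_mul_offDelannoy_succ n
  have h' := centralDelannoy_succ n
  rw [littleSchroder_succ, h']
  have hn : (n : ℚ) + 1 ≠ 0 := by positivity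
  have h'' : ((n : ℚ) + 2) * offDelannoy (n + 1) =
      (n + 1) * (2 * centralDelannoy n + 3 * offDelannoy n) := by exact_mod_cast h
  push_cast
  field_simp
  linear_combination 4 * h''

/-- The three-term recurrence of the central Delannoy numbers. -/
theorem centralDelannoy_add_two (n : ℕ) :
    ((n : ℚ) + 2) * centralDelannoy (n + 2) =
      3 * (2 * n + 3) * centralDelannoy (n + 1) - (n + 1) * centralDelannoy n := by
  have h := succ_mul_offDelannoy_succ n
  have h1 : (centralDelannoy (n + 1) : ℚ) = 3 * centralDelannoy n + 4 * offDelannoy n := by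
    exact_mod_cast centralDelannoy_succ n
  have h2 : (centralDelannoy (n + 2) : ℚ) =
      3 * centralDelannoy (n + 1) + 4 * offDelannoy (n + 1) := by
    exact_mod_cast centralDelannoy_succ (n + 1)
  have h3 : ((n : ℚ) + 2) * offDelannoy (n + 1) =
      (n + 1) * (2 * centralDelannoy n + 3 * offDelannoy n) := by exact_mod_cast h
  rw [h2, h1]
  rw [h1] at h2
  linear_combination 4 * h3

/-! ### Closed forms for the square and the consecutive product of Delannoy numbers. -/

/-- The coefficient `C(n,k) C(n+k,k)`. -/
def delannoyCoeff (n k : ℕ) : ℚ := (n.choose k : ℚ) * ((n + k).choose k : ℚ)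

@[simp] theorem delannoyCoeff_zero_right (n : ℕ) : delannoyCoeff n 0 = 1 := by
  simp [delannoyCoeff]

theorem delannoyCoeff_of_lt {n k : ℕ} (h : n < k) : delannoyCoeff n k = 0 := by
  simp [delannoyCoeff, Nat.choose_eq_zero_of_lt h]

theorem delannoyCoeff_succ_right (n k : ℕ) :
    delannoyCoeff n (k + 1) * ((k : ℚ) + 1) ^ 2 = (n - k) * (n + k + 1) * delannoyCoeff n k := by
  have h1 : (n.choose (k + 1) : ℚ) * (k + 1) = n.choose k * (n - k) := by
    rcases le_or_gt k n with h | h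
    · have := Nat.choose_succ_right_eq n k
      rw [← Nat.cast_sub h]
      exact_mod_cast this
    · simp [Nat.choose_eq_zero_of_lt h, Nat.choose_eq_zero_of_lt (h.trans (Nat.lt_succ_self k))]
  have h2 : ((n : ℚ) + k + 1) * (n + k).choose k = (n + (k + 1)).choose (k + 1) * (k + 1) := by
    exact_mod_cast Nat.add_one_mul_choose_eq (n + k) k
  rw [delannoyCoeff, delannoyCoeff]
  linear_combination ((n + (k + 1)).choose (k + 1) * (k + 1) : ℚ) * h1 -
    (n.choose k * (n - k) : ℚ) * h2

theorem delannoyCoeff_succ_succ (n k : ℕ) :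
    delannoyCoeff (n + 1) (k + 1) * ((k : ℚ) + 1) ^ 2 =
      (n + k + 2) * (n + k + 1) * delannoyCoeff n k := by
  have h1 : ((n : ℚ) + 1) * n.choose k = (n + 1).choose (k + 1) * (k + 1) := by
    exact_mod_cast Nat.add_one_mul_choose_eq n k
  have h2 : ((n : ℚ) + k + 2) * (n + 1 + k).choose k =
      (n + 1 + (k + 1)).choose (k + 1) * (k + 1) := by
    have := Nat.add_one_mul_choose_eq (n + 1 + k) k
    have h : ((n + 1 + k + 1 : ℕ) : ℚ) * (n + 1 + k).choose k =
      (n + 1 + (k + 1)).choose (k + 1) * (k + 1) := by exact_mod_cast this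
    rw [← h]
    push_cast
    ring
  have h3 : ((n + k).choose k : ℚ) * (n + k + 1) = (n + 1 + k).choose k * (n + 1) := by
    have := Nat.choose_mul_succ_eq (n + k) k
    rw [show n + k + 1 - k = n + 1 by omega, show n + k + 1 = n + 1 + k by omega] at this
    have h : ((n + k).choose k : ℚ) * ((n + 1 + k : ℕ) : ℚ) = (n + 1 + k).choose k * (n + 1) := by
      exact_mod_cast this
    rw [← h]
    push_cast
    ring
  rw [delannoyCoeff, delannoyCoeff]
  linear_combination -((n + 1 + (k + 1)).choose (k + 1) * (k + 1) : ℚ) * h1 -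
    (((n : ℚ) + 1) * n.choose k) * h2 - (((n : ℚ) + k + 2) * n.choose k) * h3

theorem delannoyCoeff_add_two_succ (n k : ℕ) :
    delannoyCoeff n (k + 1) * ((k : ℚ) + 1) ^ 2 =
      (n + 1 - k) * (n - k) * delannoyCoeff (n + 1) k := by
  cases k with
  | zero =>
    have := delannoyCoeff_succ_right n 0
    simp at this ⊢
    rw [this]; ring
  | succ k =>
    have h1 := delannoyCoeff_succ_right n (k + 1)
    have h2 := delannoyCoeff_succ_succ n k
    have h3 := delannoyCoeff_succ_right n k
    have hk : ((k : ℚ) + 1) ^ 2 ≠ 0 := by positivity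
    push_cast at *
    apply mul_right_cancel₀ hk
    linear_combination ((k : ℚ) + 1) ^ 2 * h1 - ((n : ℚ) - k) * (n - k - 1) * h2 +
      ((n : ℚ) - k - 1) * (n + k + 2) * h3

theorem delannoyCoeff_mul_add (n k : ℕ) :
    delannoyCoeff n k * (n + k + 1) = delannoyCoeff (n + 1) k * (n + 1 - k) := by
  cases k with
  | zero => simp
  | succ k =>
    have h2 := delannoyCoeff_succ_succ n k
    have h3 := delannoyCoeff_succ_right n k
    have hk : ((k : ℚ) + 1) ^ 2 ≠ 0 := by positivity
    push_cast
    apply mul_right_cancel₀ hk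
    linear_combination (n + k + 2 : ℚ) * h3 - (n - k : ℚ) * h2

theorem centralBinom_succ_mul (k : ℕ) :
    ((k + 1).centralBinom : ℚ) * (k + 1) = 2 * (2 * k + 1) * k.centralBinom := by
  have := Nat.succ_mul_centralBinom_succ k
  rw [mul_comm]
  exact_mod_cast this

/-- Moving the index of the `4 * δ k` part by one doubles its weight, so it contributes `8 = 4 * 2`
copies of the `δ` sum. This handles identities between sums that fail term by term. -/
theorem sum_mul_two_pow_shift (γ δ : ℕ → ℚ) (h0 : γ 0 = δ 0)
    (h : ∀ k, γ (k + 1) = δ (k + 1) + 4 * δ k) (M : ℕ) :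
    ∑ k ∈ range (M + 1), γ k * 2 ^ k =
      9 * ∑ k ∈ range M, δ k * 2 ^ k + δ M * 2 ^ M := by
  induction M with
  | zero => simp [h0]
  | succ M ih =>
    rw [Finset.sum_range_succ, ih, h, Finset.sum_range_succ]
    ring

/-- The closed form of `D_n ^ 2`, truncated at `M > n`. -/
def squareSum (M n : ℕ) : ℚ :=
  ∑ k ∈ range M, delannoyCoeff n k * k.centralBinom * 2 ^ k

/-- The closed form of `D_n * D_{n+1} / 3`, truncated at `M > n`. -/
def productSum (M n : ℕ) : ℚ :=
  ∑ k ∈ range M, delannoyCoeff n k * k.centralBinom * ((n + k + 1) / (n + 1)) * 2 ^ k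

theorem productSum_succ (M n : ℕ) :
    ((n : ℚ) + 2) * productSum M (n + 1) =
      (2 * n + 3) * squareSum M (n + 1) - (n + 1) * productSum M n := by
  rw [eq_sub_iff_add_eq, productSum, productSum, squareSum, mul_sum, mul_sum, mul_sum,
    ← sum_add_distrib]
  refine sum_congr rfl fun k _ => ?_
  have hn : (n : ℚ) + 1 ≠ 0 := by positivity
  have hn' : (n : ℚ) + 1 + 1 ≠ 0 := by positivity
  have h := delannoyCoeff_mul_add n k
  push_cast
  field_simp
  linear_combination (k.centralBinom : ℚ) * (n + 2) * h

theorem squareSum_add_two (M n : ℕ) (hM : n + 2 < M) :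
    ((n : ℚ) + 2) ^ 2 * squareSum M (n + 2) - (n + 1) ^ 2 * squareSum M n =
      9 * (2 * n + 3) * ((n + 2) * productSum M (n + 1) - (n + 1) * productSum M n) := by
  obtain ⟨M, rfl⟩ : ∃ M', M = M' + 1 := ⟨M - 1, by omega⟩
  have hn : (n : ℚ) + 1 ≠ 0 := by positivity
  have hn' : (n : ℚ) + 1 + 1 ≠ 0 := by positivity
  -- The two families are the summands of the two sides, without the factor 9. The boundary term at
  -- `M` vanishes because `n + 1 < M`.
  have key := sum_mul_two_pow_shift
    (fun k => (((n : ℚ) + 2) ^ 2 * delannoyCoeff (n + 2) k - (n + 1) ^ 2 * delannoyCoeff n k) *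
      k.centralBinom)
    (fun k => (2 * n + 3) * (delannoyCoeff (n + 1) k * (n + k + 2) -
      delannoyCoeff n k * (n + k + 1)) * k.centralBinom) (by simp; ring) (by
    intro k
    have h1 := delannoyCoeff_succ_succ (n + 1) k
    have h2 := delannoyCoeff_succ_right (n + 1) k
    have h3 := delannoyCoeff_add_two_succ n k
    have h4 := centralBinom_succ_mul k
    have h5 := delannoyCoeff_mul_add n k
    have hk : ((k : ℚ) + 1) ^ 2 ≠ 0 := by positivity
    have hk' : (k : ℚ) + 1 ≠ 0 := by positivity
    rw [← eq_div_iff hk] at h1 h2 h3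
    rw [← eq_div_iff hk'] at h4
    rw [h1, h2, h3, h4, h5]
    push_cast
    field_simp
    ring) M
  have z1 := delannoyCoeff_of_lt (show n + 1 < M by omega)
  have z2 := delannoyCoeff_of_lt (show n < M by omega)
  simp only [z1, z2] at key
  have e1 : productSum (M + 1) n = productSum M n := by
    simp [productSum, Finset.sum_range_succ, z2]
  have e2 : productSum (M + 1) (n + 1) = productSum M (n + 1) := by
    simp [productSum, Finset.sum_range_succ, z1]
  rw [e1, e2, squareSum, squareSum, productSum, productSum]
  simp only [mul_sum, ← sum_sub_distrib] at key ⊢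
  refine Eq.trans ?_ (key.trans ?_)
  · exact sum_congr rfl fun k _ => by ring
  · simp only [zero_mul, mul_zero, sub_zero, add_zero]
    refine sum_congr rfl fun k _ => ?_
    push_cast
    field_simp
    ring

/-- The three identities must be proved together: the three-term recurrence times `D (n+1)` yields
the next product from the known square, and the factorization of `(n+2)^2 D (n+2)^2 - (n+1)^2 D n ^
2` yields the next square from the two products. The free truncation `M` lets all sums share one
range. -/
theorem centralDelannoy_products {M n : ℕ} (hM : n + 1 < M) :
    (centralDelannoy n : ℚ) ^ 2 = squareSum M n ∧
    (centralDelannoy (n + 1) : ℚ) ^ 2 = squareSum M (n + 1) ∧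
    (centralDelannoy n : ℚ) * centralDelannoy (n + 1) = 3 * productSum M n := by
  induction n with
  | zero =>
    obtain ⟨M, rfl⟩ : ∃ M', M = M' + 2 := ⟨M - 2, by omega⟩
    have h0 : ∀ k, delannoyCoeff 0 (k + 1) = 0 := fun k => delannoyCoeff_of_lt (by omega)
    have h1 : ∀ k, delannoyCoeff 1 (k + 1 + 1) = 0 := fun k => delannoyCoeff_of_lt (by omega)
    have h2 : delannoyCoeff 1 1 = 2 := by norm_num [delannoyCoeff]
    have d0 : centralDelannoy 0 = 1 := by decide
    have d1 : centralDelannoy 1 = 3 := by decide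
    simp [squareSum, productSum, Finset.sum_range_succ', h0, h1, h2, d0, d1]
    norm_num [Nat.centralBinom]
  | succ n ih =>
    obtain ⟨h1, h2, h3⟩ := ih (by omega)
    have r := centralDelannoy_add_two n
    have r1 := productSum_succ M n
    have r2 := squareSum_add_two M n hM
    have hn : (n : ℚ) + 2 ≠ 0 := by positivity
    have r3 : (centralDelannoy (n + 1) : ℚ) * centralDelannoy (n + 2) =
        3 * productSum M (n + 1) := by
      apply mul_left_cancel₀ hn
      rw [← h2] at r1
      linear_combination (centralDelannoy (n + 1) : ℚ) * r - 3 * r1 - (n + 1 : ℚ) * h3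
    refine ⟨h2, ?_, r3⟩
    apply mul_left_cancel₀ (pow_ne_zero 2 hn)
    change _ * (centralDelannoy (n + 2) : ℚ) ^ 2 = _ * squareSum M (n + 2)
    rw [← h1] at r2
    linear_combination ((n + 2 : ℚ) * centralDelannoy (n + 2) - (n + 1) * centralDelannoy n) * r -
      r2 + 3 * (2 * n + 3) * ((n + 2) * r3 - (n + 1) * h3)

/-! ### Telescoping the sum of Delannoy times Schröder numbers. -/

/-- The closed form of `∑_{k<n} D_k s_{k+1}`, truncated at `M ≥ n`. -/
def partialSum (M n : ℕ) : ℚ :=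
  ∑ j ∈ range M, delannoyCoeff n (j + 1) * j.centralBinom * 2 ^ j / (n + 1)

theorem partialSum_succ_sub {M n : ℕ} (hM : n + 1 < M) :
    partialSum M (n + 1) - partialSum M n =
      (centralDelannoy n : ℚ) * littleSchroder (n + 1) := by
  have hn : (n : ℚ) + 1 ≠ 0 := by positivity
  have hn' : (n : ℚ) + 2 ≠ 0 := by positivity
  have hn'' : (n : ℚ) + 1 + 1 ≠ 0 := by positivity
  have hs := littleSchroder_succ_mul n
  obtain ⟨hu, -, hv⟩ := centralDelannoy_products hM
  have z : delannoyCoeff n M = 0 := delannoyCoeff_of_lt (by omega)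
  have key : 9 * productSum M n - squareSum M n =
      4 * (n + 2) * (partialSum M (n + 1) - partialSum M n) := by
    -- Rewrites `9 * productSum` as a sum that can be compared term by term with `squareSum`. The
    -- case `k = 0` is separated because `k - 1` truncates there; its term cancels against that of
    -- `squareSum`.
    have h1 := sum_mul_two_pow_shift
      (fun k => if k = 0 then 1 else
        delannoyCoeff n k * k.centralBinom * ((n + k + 1) / (n + 1)) +
          4 * (delannoyCoeff n (k - 1) * (k - 1).centralBinom * ((n + (k - 1 : ℕ) + 1) / (n + 1))))
      (fun k => delannoyCoeff n k * k.centralBinom * ((n + k + 1) / (n + 1)))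
      (by simp [hn]) (by intro k; simp) M
    rw [z, zero_mul, zero_mul, zero_mul, add_zero, ← productSum, sum_range_succ'] at h1
    have h2 : squareSum M n = squareSum (M + 1) n := by
      rw [squareSum, squareSum, sum_range_succ, z]; ring
    rw [h2, squareSum, ← h1, sum_range_succ', partialSum, partialSum, ← sum_sub_distrib, mul_sum]
    simp only [if_true, pow_zero, delannoyCoeff_zero_right, Nat.centralBinom_zero, Nat.cast_one,
      mul_one, add_sub_add_right_eq_sub, ← sum_sub_distrib]
    refine sum_congr rfl fun k _ => ?_
    have g1 := delannoyCoeff_succ_succ n k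
    have g2 := delannoyCoeff_succ_right n k
    have g4 := centralBinom_succ_mul k
    have hk : ((k : ℚ) + 1) ^ 2 ≠ 0 := by positivity
    have hk' : (k : ℚ) + 1 ≠ 0 := by positivity
    rw [← eq_div_iff hk] at g1 g2
    rw [← eq_div_iff hk'] at g4
    rw [if_neg (Nat.succ_ne_zero k), Nat.add_sub_cancel, g1, g2, g4]
    push_cast
    field_simp
    ring
  apply mul_left_cancel₀ (mul_ne_zero four_ne_zero hn')
  rw [← key]
  linear_combination -(centralDelannoy n : ℚ) * hs - 3 * hv + hu

theorem sum_centralDelannoy_mul_littleSchroder {M n : ℕ} (hM : n < M) :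
    ∑ k ∈ range n, (centralDelannoy k : ℚ) * littleSchroder (k + 1) = partialSum M n := by
  induction n with
  | zero =>
    rw [partialSum, sum_range_zero, sum_eq_zero]
    intro j _
    rw [delannoyCoeff_of_lt (Nat.succ_pos j)]
    simp
  | succ n ih => rw [sum_range_succ, ih (by omega), ← partialSum_succ_sub hM]; ring

/-! ### Integrality of the weights, the Catalan sum and its parity. -/

/-- The integer value of `w (n + 1) (j + 1)`. -/
def wInt (n j : ℕ) : ℤ :=
  n.choose j * (n + j + 2).choose (j + 1) - (n + 1).choose (j + 1) * (n + j + 2).choose j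

theorem w_succ_succ_mul (n j : ℕ) :
    (n + 2) * w (n + 1) (j + 1) = (n.choose j : ℚ) * (n + j + 2).choose (j + 1) := by
  have h1 := Nat.choose_succ_right_eq (n + j + 2) j
  rw [show n + j + 2 - j = n + 2 by omega] at h1
  have h2 : ((n + j + 2).choose (j + 1) : ℚ) * (j + 1) = (n + j + 2).choose j * (n + 2) := by
    exact_mod_cast h1
  have hj : (j : ℚ) + 1 ≠ 0 := by positivity
  rw [w, Nat.add_sub_cancel, Nat.add_sub_cancel, show n + 1 + (j + 1) = n + j + 2 by omega]
  push_cast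
  field_simp
  linear_combination -(n.choose j : ℚ) * h2

theorem w_succ_succ_mul' (n j : ℕ) :
    (n + 1) * w (n + 1) (j + 1) = ((n + 1).choose (j + 1) : ℚ) * (n + j + 2).choose j := by
  have h2 : ((n : ℚ) + 1) * n.choose j = (n + 1).choose (j + 1) * (j + 1) := by
    exact_mod_cast Nat.add_one_mul_choose_eq n j
  have hj : (j : ℚ) + 1 ≠ 0 := by positivity
  rw [w, Nat.add_sub_cancel, Nat.add_sub_cancel, show n + 1 + (j + 1) = n + j + 2 by omega]
  push_cast
  field_simp
  linear_combination ((n + j + 2).choose j : ℚ) * h2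

/-- Both `n + 2` and `n + 1` times the weight are products of binomials, and the weight is their
difference. -/
theorem w_succ_succ (n j : ℕ) : w (n + 1) (j + 1) = wInt n j := by
  rw [wInt]
  push_cast
  linear_combination w_succ_succ_mul n j - w_succ_succ_mul' n j

/-- With `p = n + 1` the factor is `p + 1`, invertible modulo `p^2`, so nothing is lost by working
with the product on the right. -/
theorem succ_mul_wInt (n j : ℕ) :
    ((n : ℤ) + 2) * wInt n j = n.choose j * (n + j + 2).choose (j + 1) := by
  have h := w_succ_succ_mul n j
  rw [w_succ_succ] at h
  exact_mod_cast h

theorem wInt_zero (n : ℕ) : wInt n 0 = 1 := by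
  simp [wInt]

/-- The integer `∑_{k=1}^{n+1} w(n+1,k) C_{k-1} 2^(k-1)`. -/
def wSum (n : ℕ) : ℤ := ∑ j ∈ range (n + 1), wInt n j * catalan j * 2 ^ j

theorem sum_w_eq (n : ℕ) :
    ∑ k ∈ Icc 1 (n + 1), w (n + 1) k * (catalan (k - 1) : ℚ) * 2 ^ (k - 1) = wSum n := by
  rw [sum_Icc_one_eq_sum_range, wSum]
  push_cast
  simp only [w_succ_succ]

theorem sum_centralDelannoy_eq_wSum (n : ℕ) :
    ∑ k ∈ range (n + 1), (centralDelannoy k : ℚ) * littleSchroder (k + 1) = (n + 1) * wSum n := by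
  rw [sum_centralDelannoy_mul_littleSchroder (M := n + 2) (by omega), partialSum,
    sum_range_succ, delannoyCoeff_of_lt (by omega : n + 1 < n + 1 + 1), wSum]
  push_cast
  rw [mul_sum]
  simp only [zero_mul, zero_div, add_zero]
  refine sum_congr rfl fun j _ => ?_
  rw [← w_succ_succ]
  have h1 := w_succ_succ_mul n j
  have h2 : ((n : ℚ) + 1) * n.choose j = (n + 1).choose (j + 1) * (j + 1) := by
    exact_mod_cast Nat.add_one_mul_choose_eq n j
  have h3 : ((j : ℚ) + 1) * catalan j = j.centralBinom := by
    exact_mod_cast succ_mul_catalan_eq_centralBinom j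
  rw [delannoyCoeff, show n + 1 + (j + 1) = n + j + 2 by omega, ← h3,
    show ((n : ℚ) + 1 + 1) = n + 2 by ring, div_eq_iff (by positivity)]
  linear_combination -((n + 1 : ℚ) * catalan j * 2 ^ j) * h1 -
    ((n + j + 2).choose (j + 1) * catalan j * 2 ^ j : ℚ) * h2

theorem wSum_odd (n : ℕ) : wSum n ≡ 1 [ZMOD 2] := by
  rw [wSum, sum_range_succ', wInt_zero]
  have : (2 : ℤ) ∣ ∑ j ∈ range n, wInt n (j + 1) * catalan (j + 1) * 2 ^ (j + 1) :=
    dvd_sum fun j _ => Dvd.intro_left _ (by rw [pow_succ, ← mul_assoc])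
  simp only [catalan_zero, Nat.cast_one, pow_zero, mul_one]
  exact (Int.modEq_iff_dvd.2 (by simpa using this)).symm

/-! ### Binomial coefficients modulo the square of a prime. -/

section PrimeSquare

variable {p : ℕ}

theorem natCast_sq_eq_zero (p : ℕ) : (p : ZMod (p ^ 2)) ^ 2 = 0 := by
  exact_mod_cast ZMod.natCast_self (p ^ 2)

theorem natCast_mul_eq_of_eq {a b : ℤ} (h : (a : ZMod p) = b) :
    (p : ZMod (p ^ 2)) * a = p * b := by
  have h1 : (p : ℤ) ∣ b - a := (ZMod.intCast_eq_intCast_iff_dvd_sub _ _ _).1 h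
  have h2 : ((p * a : ℤ) : ZMod (p ^ 2)) = (p * b : ℤ) := by
    rw [ZMod.intCast_eq_intCast_iff_dvd_sub, ← mul_sub, Nat.cast_pow, sq]
    exact mul_dvd_mul_left _ h1
  exact_mod_cast h2

theorem isUnit_natCast_prime_sq (hp : p.Prime) {k : ℕ} (h0 : 0 < k) (hk : k < p) :
    IsUnit (k : ZMod (p ^ 2)) := by
  rw [ZMod.isUnit_iff_coprime]
  exact (Nat.coprime_of_lt_prime h0.ne' hk hp).symm.pow_right 2

/-- In Vandermonde's convolution every inner term is a product of two multiples of `p`; only the two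
end terms survive. -/
theorem choose_two_mul_prime (hp : p.Prime) {k : ℕ} (h0 : 0 < k) (hk : k ≤ p) :
    ((2 * p).choose k : ZMod (p ^ 2)) = 2 * p.choose k := by
  obtain ⟨m, rfl⟩ : ∃ m, k = m + 1 := ⟨k - 1, by omega⟩
  rw [two_mul, Nat.add_choose_eq,
    Finset.Nat.sum_antidiagonal_eq_sum_range_succ (fun i j => p.choose i * p.choose j),
    sum_range_succ, sum_range_succ']
  push_cast
  rw [sum_eq_zero]
  · simp; ring
  · intro i hi
    have hi' : i < m := mem_range.1 hi
    have h1 : p ∣ p.choose (i + 1) := hp.dvd_choose_self (by omega) (by omega)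
    have h2 : p ∣ p.choose (m - i) := hp.dvd_choose_self (by omega) (by omega)
    have h3 := mul_dvd_mul h1 h2
    rw [← sq] at h3
    rw [← Nat.cast_mul]
    exact (ZMod.natCast_eq_zero_iff _ _).2 h3

/-- With `p = n + 1` the product is that of `(p - i)(p + i) / i^2 = (p^2 - i^2) / i^2` over `1 ≤ i ≤
j`, and each factor is `-1` modulo `p^2`. -/
theorem choose_mul_choose_eq_neg_one_pow {n : ℕ} (hp : (n + 1).Prime) {j : ℕ} (hj : j ≤ n) :
    (n.choose j * (n + 1 + j).choose j : ZMod ((n + 1) ^ 2)) = (-1) ^ j := by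
  induction j with
  | zero => simp
  | succ j ih =>
    have ih := ih (by omega)
    have h1 : (n.choose (j + 1) * (j + 1) : ZMod ((n + 1) ^ 2)) = n.choose j * (n - j) := by
      rw [← Nat.cast_sub (by omega)]
      exact_mod_cast congrArg (Nat.cast (R := ZMod ((n + 1) ^ 2))) (Nat.choose_succ_right_eq n j)
    have h2 : ((n + 1 + j + 1) * (n + 1 + j).choose j : ZMod ((n + 1) ^ 2)) =
        (n + 1 + (j + 1)).choose (j + 1) * (j + 1) := by
      exact_mod_cast congrArg (Nat.cast (R := ZMod ((n + 1) ^ 2)))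
        (Nat.add_one_mul_choose_eq (n + 1 + j) j)
    have h3 : ((n : ZMod ((n + 1) ^ 2)) + 1) ^ 2 = 0 := by
      exact_mod_cast natCast_sq_eq_zero (n + 1)
    have h4 : IsUnit ((j : ZMod ((n + 1) ^ 2)) + 1) := by
      exact_mod_cast isUnit_natCast_prime_sq hp (Nat.succ_pos j) (by omega)
    apply (h4.pow 2).mul_left_cancel
    linear_combination ((n + 1 + (j + 1)).choose (j + 1) * (j + 1) : ZMod ((n + 1) ^ 2)) * h1 -
      (n.choose j * (n - j) : ZMod ((n + 1) ^ 2)) * h2 +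
      ((n - j) * (n + 1 + j + 1) : ZMod ((n + 1) ^ 2)) * ih + (-1) ^ j * h3

theorem choose_prime_add_self [Fact p.Prime] {j : ℕ} (hj : j < p) :
    ((p + j).choose j : ZMod p) = 1 := by
  have h := Choose.choose_modEq_choose_mod_mul_choose_div_nat (p := p) (n := p + j) (k := j)
  have h0 : 0 < p := by omega
  rw [Nat.add_mod_left, Nat.mod_eq_of_lt hj, Nat.choose_self, Nat.div_eq_of_lt hj,
    Nat.choose_zero_right] at h
  simpa using (ZMod.natCast_eq_natCast_iff _ _ _).2 h

/-- Pascal's rule splits the second binomial. One part is `choose_mul_choose_eq_neg_one_pow`; the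
other equals `C(p,j+1) C(p+j,j)`, where the first factor is divisible by `p` and so the second
matters only modulo `p`, where it is 1. -/
theorem choose_mul_choose_succ {n : ℕ} (hp : (n + 1).Prime) {j : ℕ} (hj : j < n) :
    (n.choose j * (n + j + 2).choose (j + 1) : ZMod ((n + 1) ^ 2)) =
      (-1) ^ j + (n + 1).choose (j + 1) := by
  have := Fact.mk hp
  have h1 : n.choose j * (n + 1 + j).choose (j + 1) =
      (n + 1).choose (j + 1) * (n + 1 + j).choose j := by
    have e1 := Nat.choose_succ_right_eq (n + 1 + j) j
    rw [Nat.add_sub_cancel] at e1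
    have e2 := Nat.add_one_mul_choose_eq n j
    apply Nat.eq_of_mul_eq_mul_right (show 0 < j + 1 by omega)
    linear_combination n.choose j * e1 + (n + 1 + j).choose j * e2
  obtain ⟨c, hc⟩ := hp.dvd_choose_self (k := j + 1) (by omega) (by omega)
  have h2 : ((n + 1).choose (j + 1) * (n + 1 + j).choose j : ZMod ((n + 1) ^ 2)) =
      (n + 1).choose (j + 1) := by
    have h := natCast_mul_eq_of_eq (p := n + 1) (a := (n + 1 + j).choose j) (b := 1)
      (by simpa using choose_prime_add_self (p := n + 1) (j := j) (by omega))
    rw [hc]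
    push_cast at h ⊢
    linear_combination (c : ZMod ((n + 1) ^ 2)) * h
  have h3 := choose_mul_choose_eq_neg_one_pow hp (j := j) (by omega)
  have h4 : (n.choose j * (n + 1 + j).choose (j + 1) : ZMod ((n + 1) ^ 2)) =
      (n + 1).choose (j + 1) * (n + 1 + j).choose j := by exact_mod_cast congrArg _ h1
  rw [show n + j + 2 = n + 1 + j + 1 by omega, Nat.choose_succ_succ']
  push_cast
  linear_combination h3 + h4 + h2

end PrimeSquare

/-! ### The alternating Catalan sum modulo the square of a prime. -/

theorem centralBinom_succ_eq (n : ℕ) :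
    ((n + 1).centralBinom : ℤ) = 4 * n.centralBinom - 2 * catalan n := by
  have h1 : ((n : ℤ) + 1) * (n + 1).centralBinom = 2 * (2 * n + 1) * n.centralBinom := by
    exact_mod_cast Nat.succ_mul_centralBinom_succ n
  have h2 : ((n : ℤ) + 1) * catalan n = n.centralBinom := by
    exact_mod_cast succ_mul_catalan_eq_centralBinom n
  apply mul_left_cancel₀ (show (n : ℤ) + 1 ≠ 0 by positivity)
  linear_combination h1 + 2 * h2

theorem choose_two_mul_succ_eq (n : ℕ) :
    ((2 * n).choose (n + 1) : ℤ) = n.centralBinom - catalan n := by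
  have h := Nat.choose_succ_right_eq (2 * n) n
  rw [show 2 * n - n = n by omega, ← Nat.centralBinom_eq_two_mul_choose] at h
  have h1 : ((2 * n).choose (n + 1) : ℤ) * (n + 1) = n.centralBinom * n := by exact_mod_cast h
  have h2 : ((n : ℤ) + 1) * catalan n = n.centralBinom := by
    exact_mod_cast succ_mul_catalan_eq_centralBinom n
  apply mul_left_cancel₀ (show (n : ℤ) + 1 ≠ 0 by positivity)
  linear_combination h1 + h2

/-- The lower half of the binomial expansion of `(1 - 2) ^ (2 * n)`. -/
def halfBinomSum (n : ℕ) : ℤ := ∑ m ∈ range (n + 1), ((2 * n).choose m : ℤ) * (-2) ^ m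

/-- Applying Pascal's rule twice expresses the new sum through three shifts of the old one with
multipliers `1`, `-4`, `4`. These add up to 1, so only boundary terms near the middle binomial
remain. -/
theorem halfBinomSum_succ (n : ℕ) :
    halfBinomSum (n + 1) = halfBinomSum n +
      (-2) ^ n * (2 * catalan n - 6 * n.centralBinom) := by
  have a0 : halfBinomSum n =
      ∑ m ∈ range n, ((2 * n).choose m : ℤ) * (-2) ^ m + n.centralBinom * (-2) ^ n := by
    rw [halfBinomSum, sum_range_succ, Nat.centralBinom_eq_two_mul_choose]
  have a1 : halfBinomSum n =
      ∑ m ∈ range n, ((2 * n).choose (m + 1) : ℤ) * (-2) ^ (m + 1) + 1 := by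
    rw [halfBinomSum, sum_range_succ']
    simp
  have a2 : halfBinomSum n + ((2 * n).choose (n + 1) : ℤ) * (-2) ^ (n + 1) =
      ∑ m ∈ range n, ((2 * n).choose (m + 2) : ℤ) * (-2) ^ (m + 2) + 2 * n * (-2) + 1 := by
    rw [halfBinomSum, ← sum_range_succ, sum_range_succ', sum_range_succ']
    simp
  have a3 : halfBinomSum (n + 1) =
      ∑ m ∈ range n, ((2 * (n + 1)).choose (m + 2) : ℤ) * (-2) ^ (m + 2) +
        2 * (n + 1) * (-2) + 1 := by
    rw [halfBinomSum, sum_range_succ', sum_range_succ']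
    simp
  have a4 : ∑ m ∈ range n, ((2 * (n + 1)).choose (m + 2) : ℤ) * (-2) ^ (m + 2) =
      ∑ m ∈ range n, ((2 * n).choose (m + 2) : ℤ) * (-2) ^ (m + 2) -
      4 * ∑ m ∈ range n, ((2 * n).choose (m + 1) : ℤ) * (-2) ^ (m + 1) +
      4 * ∑ m ∈ range n, ((2 * n).choose m : ℤ) * (-2) ^ m := by
    rw [mul_sum, mul_sum, ← sum_sub_distrib, ← sum_add_distrib]
    refine sum_congr rfl fun m _ => ?_
    rw [show 2 * (n + 1) = 2 * n + 1 + 1 by ring, Nat.choose_succ_succ' (2 * n + 1) (m + 1),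
      Nat.choose_succ_succ' (2 * n) (m + 1), Nat.choose_succ_succ' (2 * n) m]
    push_cast
    ring
  have a5 := choose_two_mul_succ_eq n
  rw [a5] at a2
  linear_combination a3 + a4 - a2 + 4 * a1 - 4 * a0

theorem two_mul_sum_catalan (n : ℕ) :
    2 * ∑ k ∈ range n, (catalan k : ℤ) * (-2) ^ k =
      1 - 3 * halfBinomSum n + 2 * n.centralBinom * (-2) ^ n := by
  induction n with
  | zero => simp [halfBinomSum]
  | succ n ih =>
    rw [sum_range_succ, halfBinomSum_succ, centralBinom_succ_eq]
    linear_combination ih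

/-- Replacing `C(2p,k)` by `2 C(p,k)` for `k > 0` turns the half sum into `1 + 2 ((1 - 2)^p - 1)`.
-/
theorem halfBinomSum_prime {p : ℕ} (hp : p.Prime) (ho : Odd p) :
    (halfBinomSum p : ZMod (p ^ 2)) = -3 := by
  have h := add_pow (-2 : ZMod (p ^ 2)) 1 p
  rw [sum_range_succ'] at h
  rw [halfBinomSum, sum_range_succ']
  have h1 : ((-2 : ZMod (p ^ 2)) + 1) ^ p = -1 := by
    rw [show (-2 : ZMod (p ^ 2)) + 1 = -1 by ring, ho.neg_one_pow]
  rw [h1] at h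
  have h2 : ((∑ k ∈ range p, ((2 * p).choose (k + 1) : ℤ) * (-2) ^ (k + 1) : ℤ) : ZMod (p ^ 2)) =
      2 * ∑ k ∈ range p, (-2) ^ (k + 1) * 1 ^ (p - (k + 1)) * (p.choose (k + 1) : ZMod (p ^ 2)) := by
    push_cast
    rw [mul_sum]
    refine sum_congr rfl fun k hk => ?_
    rw [choose_two_mul_prime hp (Nat.succ_pos k) (mem_range.1 hk)]
    ring
  push_cast at h2 ⊢
  rw [h2]
  simp at h ⊢
  linear_combination -2 * h

theorem sum_catalan_prime {p : ℕ} (hp : p.Prime) (ho : Odd p) :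
    ∑ k ∈ range p, (catalan k : ZMod (p ^ 2)) * (-2) ^ k = 5 - 2 * 2 ^ p := by
  have h := congrArg (Int.cast (R := ZMod (p ^ 2))) (two_mul_sum_catalan p)
  have h1 := halfBinomSum_prime hp ho
  have h2 := choose_two_mul_prime hp hp.pos le_rfl
  have hu : IsUnit ((2 : ℕ) : ZMod (p ^ 2)) :=
    isUnit_natCast_prime_sq hp two_pos (lt_of_le_of_ne hp.two_le (by rintro rfl; revert ho; decide))
  apply hu.mul_left_cancel
  push_cast at h ⊢
  rw [h, h1, Nat.centralBinom_eq_two_mul_choose, h2, ho.neg_pow, Nat.choose_self]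
  push_cast
  ring

/-- From `C(2p,p) = 2 (2p - 1) C_{p-1}` and `C(2p,p) ≡ 2`, the value is the inverse of `2p - 1`. -/
theorem catalan_prime_pred {n : ℕ} (hp : (n + 1).Prime) (ho : Odd (n + 1)) :
    (catalan n : ZMod ((n + 1) ^ 2)) = -(1 + 2 * (n + 1)) := by
  have h0 : ((n + 1).centralBinom : ZMod ((n + 1) ^ 2)) = 2 := by
    rw [Nat.centralBinom_eq_two_mul_choose, choose_two_mul_prime hp hp.pos le_rfl]
    simp
  have h1 : (n + 1).centralBinom = 2 * (2 * n + 1) * catalan n := by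
    have h2 := Nat.succ_mul_centralBinom_succ n
    rw [← succ_mul_catalan_eq_centralBinom n] at h2
    apply Nat.eq_of_mul_eq_mul_left (show 0 < n + 1 by omega)
    linear_combination h2
  have hu : IsUnit ((2 : ℕ) : ZMod ((n + 1) ^ 2)) :=
    isUnit_natCast_prime_sq hp two_pos
      (lt_of_le_of_ne hp.two_le (by intro h; rw [← h] at ho; revert ho; decide))
  have h3 : ((n : ZMod ((n + 1) ^ 2)) + 1) ^ 2 = 0 := by
    exact_mod_cast natCast_sq_eq_zero (n + 1)
  rw [h1] at h0
  apply hu.mul_left_cancel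
  push_cast at h0 ⊢
  linear_combination -(1 + 2 * (n + 1 : ZMod ((n + 1) ^ 2))) * h0 + 8 * catalan n * h3

/-! ### Truncated logarithm identities over a field. -/

section Field

variable {F : Type*} [Field F]

/-- Formally, both sides integrate `((1 + t)^n - 1) / t`, the geometric sum of the `(1 + t)^i`, from
0 to `x`. Induction on `n` replaces the integration, so only the denominators that occur need be
nonzero. -/
theorem sum_choose_mul_pow_div (x : F) {n : ℕ} (hn : ∀ i < n, (i : F) + 1 ≠ 0) :
    ∑ j ∈ range n, (n.choose (j + 1) : F) * x ^ (j + 1) / (j + 1) =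
      ∑ i ∈ range n, ((1 + x) ^ (i + 1) - 1) / (i + 1) := by
  induction n with
  | zero => simp
  | succ n ih =>
    have hn1 := hn n (Nat.lt_succ_self n)
    rw [sum_range_succ (fun i : ℕ => ((1 + x) ^ (i + 1) - 1) / ((i : F) + 1)) n,
      ← ih fun i hi => hn i (by omega)]
    have h1 : (1 + x) ^ (n + 1) - 1 =
        ∑ j ∈ range (n + 1), ((n + 1).choose (j + 1) : F) * x ^ (j + 1) := by
      rw [add_comm, add_pow, sum_range_succ']
      simp [mul_comm]
    have h2 : ∑ j ∈ range n, (n.choose (j + 1) : F) * x ^ (j + 1) / (j + 1) =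
        ∑ j ∈ range (n + 1), (n.choose (j + 1) : F) * x ^ (j + 1) / (j + 1) := by
      simp [sum_range_succ]
    rw [h1, h2, sum_div, ← sum_add_distrib]
    refine sum_congr rfl fun j hj => ?_
    have hj1 := hn j (mem_range.1 hj)
    have h3 : ((n : F) + 1) * n.choose j = (n + 1).choose (j + 1) * (j + 1) := by
      exact_mod_cast congrArg (Nat.cast (R := F)) (Nat.add_one_mul_choose_eq n j)
    have h4 : ((n + 1).choose (j + 1) : F) = n.choose j + n.choose (j + 1) := by
      exact_mod_cast congrArg (Nat.cast (R := F)) (Nat.choose_succ_succ' n j)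
    have h5 : ((n + 1).choose (j + 1) : F) * x ^ (j + 1) / (n + 1) =
        n.choose j * x ^ (j + 1) / (j + 1) := by
      rw [div_eq_div_iff hn1 hj1]
      linear_combination -x ^ (j + 1) * h3
    rw [h5, h4]
    ring

theorem sum_even_pow_div (h2 : (2 : F) ≠ 0) (x : F) (h : ℕ) :
    ∑ k ∈ range (2 * h), (x ^ (k + 1) + (-x) ^ (k + 1)) / ((k : F) + 1) =
      ∑ i ∈ range h, (x ^ 2) ^ (i + 1) / ((i : F) + 1) := by
  induction h with
  | zero => simp
  | succ h ih =>
    rw [mul_add, mul_one, sum_range_succ, sum_range_succ, sum_range_succ, ih, add_assoc]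
    congr 1
    have e1 : (-x) ^ (2 * h + 1) = -x ^ (2 * h + 1) := (odd_two_mul_add_one h).neg_pow x
    have e2 : (-x) ^ (2 * h + 1 + 1) = x ^ (2 * h + 1 + 1) := Even.neg_pow ⟨h + 1, by ring⟩ x
    rw [e1, e2, add_neg_cancel, zero_div, zero_add, ← pow_mul]
    push_cast
    rw [show x ^ (2 * h + 1 + 1) + x ^ (2 * h + 1 + 1) = 2 * x ^ (2 * (h + 1)) by ring,
      show (2 * (h : F) + 1 + 1) = 2 * (h + 1) by ring, mul_div_mul_left _ _ h2]

end Field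

/-! ### The second Catalan sum modulo a prime. -/

section Prime

variable {n h : ℕ}

theorem succ_ne_zero_zmod {p i : ℕ} (hi : i + 1 < p) : (i : ZMod p) + 1 ≠ 0 := by
  intro h0
  have : ((i + 1 : ℕ) : ZMod p) = 0 := by exact_mod_cast h0
  exact absurd (Nat.le_of_dvd (Nat.succ_pos i) ((ZMod.natCast_eq_zero_iff _ _).1 this)) (by omega)

theorem choose_prime_pred {j : ℕ} [Fact (n + 1).Prime] (hj : j ≤ n) :
    (n.choose j : ZMod (n + 1)) = (-1) ^ j := by
  induction j with
  | zero => simp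
  | succ j ih =>
    have ih := ih (by omega)
    have h1 : (n.choose (j + 1) * (j + 1) : ZMod (n + 1)) = n.choose j * (n - j) := by
      rw [← Nat.cast_sub (by omega)]
      exact_mod_cast congrArg (Nat.cast (R := ZMod (n + 1))) (Nat.choose_succ_right_eq n j)
    have h2 : (n : ZMod (n + 1)) + 1 = 0 := by exact_mod_cast ZMod.natCast_self (n + 1)
    apply mul_right_cancel₀ (succ_ne_zero_zmod (p := n + 1) (i := j) (by omega))
    rw [ih] at h1
    linear_combination h1 + (-1) ^ j * h2

/-- The integer `C(p,k)/p` where `p = n + 1` and `k = j + 1`. -/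
def chooseQuot (n j : ℕ) : ℕ := (n + 1).choose (j + 1) / (n + 1)

theorem mul_chooseQuot (hp : (n + 1).Prime) {j : ℕ} (hj : j < n) :
    (n + 1) * chooseQuot n j = (n + 1).choose (j + 1) :=
  Nat.mul_div_cancel' (hp.dvd_choose_self (by omega) (by omega))

theorem chooseQuot_eq [hp : Fact (n + 1).Prime] {j : ℕ} (hj : j < n) :
    (chooseQuot n j : ZMod (n + 1)) = (-1) ^ j / (j + 1) := by
  rw [eq_div_iff (succ_ne_zero_zmod (by omega)), ← choose_prime_pred hj.le]
  have h : chooseQuot n j * (j + 1) = n.choose j := by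
    have h1 := Nat.add_one_mul_choose_eq n j
    rw [← mul_chooseQuot hp.out hj] at h1
    apply Nat.eq_of_mul_eq_mul_left (show 0 < n + 1 by omega)
    linear_combination -h1
  exact_mod_cast congrArg _ h

/-- Divide the expansions of `(1 + x)^p` and `(1 - x)^p` by `p` and use `C(p,k)/p ≡ (-1)^(k-1)/k`;
the outer terms `x^p` and `(-x)^p` cancel since `p` is odd. -/
theorem sum_pow_div_of_prime [hp : Fact (n + 1).Prime] (ho : Odd (n + 1)) (x m : ℤ)
    (hm : ((n + 1 : ℕ) : ℤ) * m = (1 - x) ^ (n + 1) + (1 + x) ^ (n + 1) - 2) :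
    ∑ k ∈ range n, ((x : ZMod (n + 1)) ^ (k + 1) + (-x) ^ (k + 1)) / ((k : ZMod (n + 1)) + 1) =
      -m := by
  have key : ∀ y : ℤ, ((n + 1 : ℕ) : ℤ) * ∑ k ∈ range n, (chooseQuot n k : ℤ) * y ^ (k + 1) =
      (1 + y) ^ (n + 1) - 1 - y ^ (n + 1) := by
    intro y
    rw [add_comm 1 y, add_pow, sum_range_succ', sum_range_succ, mul_sum]
    have : ∀ k ∈ range n, ((n + 1 : ℕ) : ℤ) * ((chooseQuot n k : ℤ) * y ^ (k + 1)) =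
        y ^ (k + 1) * 1 ^ (n + 1 - (k + 1)) * ((n + 1).choose (k + 1) : ℤ) := by
      intro k hk
      rw [← mul_chooseQuot hp.out (mem_range.1 hk)]
      push_cast
      ring
    rw [sum_congr rfl this]
    simp
  have h1 : m = ∑ k ∈ range n, (chooseQuot n k : ℤ) * (-x) ^ (k + 1) +
      ∑ k ∈ range n, (chooseQuot n k : ℤ) * x ^ (k + 1) := by
    apply mul_left_cancel₀ (show ((n + 1 : ℕ) : ℤ) ≠ 0 by positivity)
    rw [mul_add, key, key, hm, ho.neg_pow]
    ring
  rw [h1, ← sum_add_distrib]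
  push_cast
  rw [← sum_neg_distrib]
  refine sum_congr rfl fun k hk => ?_
  rw [chooseQuot_eq (mem_range.1 hk), neg_pow _ (k + 1), pow_succ (-1) k]
  have e : ((-1 : ZMod (n + 1)) ^ k) * (-1) ^ k = 1 := by rw [← mul_pow]; simp
  rw [div_eq_iff (succ_ne_zero_zmod (by have := mem_range.1 hk; omega))]
  have hk0 : (k : ZMod (n + 1)) + 1 ≠ 0 :=
    succ_ne_zero_zmod (by have := mem_range.1 hk; omega)
  field_simp
  linear_combination -(x : ZMod (n + 1)) ^ (k + 1) * e

/-- Modulo `p = 2h + 1` one has `h ≡ -1/2`, and `C(2j,j) = (-4)^j C(-1/2,j)`. -/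
theorem centralBinom_half [Fact (2 * h + 1).Prime] {j : ℕ} (hj : j ≤ 2 * h) :
    (j.centralBinom : ZMod (2 * h + 1)) = h.choose j * (-4) ^ j := by
  induction j with
  | zero => simp
  | succ j ih =>
    have ih := ih (by omega)
    have h0 : 2 * (h : ZMod (2 * h + 1)) + 1 = 0 := by
      exact_mod_cast ZMod.natCast_self (2 * h + 1)
    have h1 : (h.choose (j + 1) * (j + 1) : ZMod (2 * h + 1)) = h.choose j * (h - j) := by
      rcases le_or_gt j h with hjh | hjh
      · rw [← Nat.cast_sub hjh]
        exact_mod_cast congrArg (Nat.cast (R := ZMod (2 * h + 1))) (Nat.choose_succ_right_eq h j)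
      · simp [Nat.choose_eq_zero_of_lt hjh, Nat.choose_eq_zero_of_lt (hjh.trans j.lt_succ_self)]
    have h2 : ((j : ZMod (2 * h + 1)) + 1) * (j + 1).centralBinom =
        2 * (2 * j + 1) * j.centralBinom := by
      exact_mod_cast congrArg (Nat.cast (R := ZMod (2 * h + 1))) (Nat.succ_mul_centralBinom_succ j)
    apply mul_left_cancel₀ (succ_ne_zero_zmod (p := 2 * h + 1) (i := j) (by omega))
    rw [ih] at h2
    linear_combination h2 - (-4) ^ (j + 1) * h1 + 2 * h.choose j * (-4) ^ j * h0

theorem sum_chooseQuot_mul_catalan [hp : Fact (2 * h + 1).Prime] {q : ℤ}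
    (hq : (2 : ℤ) ^ (2 * h) = 1 + ((2 * h + 1 : ℕ) : ℤ) * q) :
    ∑ j ∈ range (2 * h), (chooseQuot (2 * h) j * catalan j * 2 ^ j : ZMod (2 * h + 1)) = 4 - q := by
  have ho : Odd (2 * h + 1) := odd_two_mul_add_one h
  have hh : 0 < h := by
    rcases Nat.eq_zero_or_pos h with rfl | h0
    · exact absurd hp.out (by norm_num)
    · exact h0
  have h0 : 2 * (h : ZMod (2 * h + 1)) + 1 = 0 := by
    exact_mod_cast ZMod.natCast_self (2 * h + 1)
  have two : (2 : ZMod (2 * h + 1)) ≠ 0 := by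
    have := succ_ne_zero_zmod (p := 2 * h + 1) (i := 1) (by omega)
    norm_num at this
    exact this
  have four : (4 : ZMod (2 * h + 1)) ≠ 0 := by
    rw [show (4 : ZMod (2 * h + 1)) = 2 * 2 by norm_num]
    exact mul_ne_zero two two
  have hn : ∀ i < 2 * h, (i : ZMod (2 * h + 1)) + 1 ≠ 0 := fun i hi =>
    succ_ne_zero_zmod (by omega)
  have hh1 : (h : ZMod (2 * h + 1)) + 1 ≠ 0 := hn h (by omega)
  -- As `h + 1 ≡ 1/2`, the Catalan number is `2 C(h+1,j+1) (-4)^j`; the sign cancels that of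
  -- `chooseQuot` and the powers combine to `8^j`.
  have s1 : ∀ j ∈ range (2 * h), (chooseQuot (2 * h) j * catalan j * 2 ^ j : ZMod (2 * h + 1)) =
      4⁻¹ * (((h + 1).choose (j + 1) : ZMod (2 * h + 1)) * 8 ^ (j + 1) / (j + 1)) := by
    intro j hj
    have hj' := mem_range.1 hj
    have hj0 := hn j hj'
    have c1 : ((j : ZMod (2 * h + 1)) + 1) * catalan j = h.choose j * (-4) ^ j := by
      rw [← centralBinom_half hj'.le]
      exact_mod_cast congrArg (Nat.cast (R := ZMod (2 * h + 1)))
        (succ_mul_catalan_eq_centralBinom j)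
    have c2 : ((h : ZMod (2 * h + 1)) + 1) * h.choose j = (h + 1).choose (j + 1) * (j + 1) := by
      exact_mod_cast congrArg (Nat.cast (R := ZMod (2 * h + 1))) (Nat.add_one_mul_choose_eq h j)
    have c3 : (h.choose j : ZMod (2 * h + 1)) = 2 * ((h + 1).choose (j + 1) * (j + 1)) := by
      linear_combination 2 * c2 - h.choose j * h0
    have c4 : (catalan j : ZMod (2 * h + 1)) = 2 * (h + 1).choose (j + 1) * (-4) ^ j := by
      apply mul_left_cancel₀ hj0
      rw [c1, c3]
      ring
    have e : (-1 : ZMod (2 * h + 1)) ^ j * (-4) ^ j * 2 ^ j = 8 ^ j := by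
      rw [← mul_pow, ← mul_pow]; norm_num
    rw [chooseQuot_eq hj', c4, pow_succ, ← e]
    field_simp
    ring
  have s2 : ∑ j ∈ range (2 * h), ((h + 1).choose (j + 1) : ZMod (2 * h + 1)) * 8 ^ (j + 1) /
      (j + 1) = ∑ j ∈ range (h + 1), ((h + 1).choose (j + 1) : ZMod (2 * h + 1)) * 8 ^ (j + 1) /
      (j + 1) := by
    symm
    apply sum_subset (range_subset_range.2 (by omega))
    intro j _ hj
    rw [Nat.choose_eq_zero_of_lt (by simpa using hj)]
    simp
  -- With `x = 8` above, the sums needed are those of `9^i/i` and `1/i`, the even-index halves for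
  -- `x = 3` and `x = 1`. The quotients come from `2^p = 2 (1 + p q)` and `4^p = 4 (1 + p q)^2`.
  have t1 := sum_pow_div_of_prime (n := 2 * h) ho 1 (2 * q) (by
    rw [pow_succ (1 + 1)]; norm_num [hq]; ring)
  have t3 := sum_pow_div_of_prime (n := 2 * h) ho 3 (6 * q + 4 * (2 * h + 1 : ℕ) * q ^ 2) (by
    rw [show (1 - 3 : ℤ) = -2 by norm_num, ho.neg_pow, show (1 + 3 : ℤ) = 2 ^ 2 by norm_num,
      ← pow_mul, mul_comm 2 (2 * h + 1), pow_mul, pow_succ 2 (2 * h), hq]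
    ring)
  rw [sum_even_pow_div two] at t1 t3
  have n9 : (9 : ZMod (2 * h + 1)) ^ (h + 1) = 9 := by
    have f := ZMod.pow_card (3 : ZMod (2 * h + 1))
    rw [show (9 : ZMod (2 * h + 1)) = 3 ^ 2 by norm_num, ← pow_mul,
      show 2 * (h + 1) = 2 * h + 1 + 1 by ring, pow_succ, f]
    norm_num
  rw [sum_congr rfl s1, ← mul_sum, s2, sum_choose_mul_pow_div _ (fun i hi => hn i (by omega)),
    sum_range_succ]
  norm_num [n9]
  push_cast at t1 t3
  norm_num at t1 t3
  -- The top term `i = h` lies outside the even-index sums: its numerator is `9 - 1` by Fermat, and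
  -- `h + 1 ≡ 1/2`.
  have t16 : (8 : ZMod (2 * h + 1)) / (h + 1) = 16 := by
    rw [div_eq_iff hh1]
    linear_combination -8 * h0
  simp only [sub_div, sum_sub_distrib, one_div, t1, t3, t16]
  rw [inv_mul_eq_iff_eq_mul₀ four]
  linear_combination -4 * (q : ZMod (2 * h + 1)) ^ 2 * h0

end Prime

/-! ### Assembling the congruence. -/

theorem wSum_modEq {h : ℕ} (hp : (2 * h + 1).Prime) {q : ℤ}
    (hq : (2 : ℤ) ^ (2 * h) = 1 + ((2 * h + 1 : ℕ) : ℤ) * q) :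
    wSum (2 * h) ≡ 2 * ((2 * h + 1 : ℕ) : ℤ) * (1 - 3 * q) [ZMOD ((2 * h + 1 : ℕ) : ℤ) ^ 2] := by
  have : Fact (2 * h + 1).Prime := ⟨hp⟩
  have ho : Odd (2 * h + 1) := odd_two_mul_add_one h
  have hπ : (2 * (h : ZMod ((2 * h + 1) ^ 2)) + 1) ^ 2 = 0 := by exact_mod_cast natCast_sq_eq_zero (2 * h + 1)
  have hq' : (2 : ZMod ((2 * h + 1) ^ 2)) ^ (2 * h) = 1 + (2 * h + 1) * q := by
    have := congrArg (Int.cast (R := ZMod ((2 * h + 1) ^ 2))) hq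
    push_cast at this
    exact this
  have hP : ∑ j ∈ range (2 * h), ((2 * h + 1).choose (j + 1) * catalan j * 2 ^ j : ZMod ((2 * h + 1) ^ 2)) =
      (2 * h + 1) * (4 - q) := by
    have h1 := natCast_mul_eq_of_eq (p := 2 * h + 1)
      (a := ∑ j ∈ range (2 * h), (chooseQuot (2 * h) j * catalan j * 2 ^ j : ℤ)) (b := 4 - q)
      (by push_cast; exact sum_chooseQuot_mul_catalan hq)
    push_cast at h1
    rw [← h1, mul_sum]
    refine sum_congr rfl fun j hj => ?_
    rw [← mul_chooseQuot hp (mem_range.1 hj)]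
    push_cast
    ring
  have hT := sum_catalan_prime hp ho
  have hY := catalan_prime_pred (n := 2 * h) hp ho
  have hX := choose_two_mul_prime hp hp.pos le_rfl
  rw [sum_range_succ, Even.neg_pow (even_two_mul h), pow_succ 2 (2 * h)] at hT
  have hV : ((2 * h : ZMod ((2 * h + 1) ^ 2)) + 2) * wSum (2 * h) = ∑ j ∈ range (2 * h), (catalan j : ZMod ((2 * h + 1) ^ 2)) * (-2) ^ j +
      ∑ j ∈ range (2 * h), ((2 * h + 1).choose (j + 1) * catalan j * 2 ^ j : ZMod ((2 * h + 1) ^ 2)) +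
      2 * (catalan (2 * h) * 2 ^ (2 * h)) := by
    rw [wSum, sum_range_succ]
    push_cast
    have hw : ∀ j, ((2 * h : ZMod ((2 * h + 1) ^ 2)) + 2) * wInt (2 * h) j =
        (2 * h).choose j * (2 * h + j + 2).choose (j + 1) := by
      intro j
      exact_mod_cast congrArg (Int.cast (R := ZMod ((2 * h + 1) ^ 2))) (succ_mul_wInt (2 * h) j)
    rw [mul_add, ← mul_assoc, ← mul_assoc, hw, mul_sum, ← sum_add_distrib]
    congr 1
    · refine sum_congr rfl fun j hj => ?_
      rw [← mul_assoc, ← mul_assoc, hw, choose_mul_choose_succ hp (mem_range.1 hj), neg_pow 2 j]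
      ring
    · rw [show 2 * h + 2 * h + 2 = 2 * (2 * h + 1) by ring, hX]
      simp
      ring
  have hfin : ((wSum (2 * h) : ℤ) : ZMod ((2 * h + 1) ^ 2)) =
      ((2 * ((2 * h + 1 : ℕ) : ℤ) * (1 - 3 * q) : ℤ) : ZMod ((2 * h + 1) ^ 2)) := by
    push_cast at hY ⊢
    rw [hP] at hV
    rw [hY, hq'] at hT hV
    -- With `p = 2h + 1`, the multiplier `-2h = 1 - p` is the inverse of `1 + p` modulo `p^2`.
    linear_combination (-2 * (h : ZMod ((2 * h + 1) ^ 2))) * (hV + hT) +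
      (wSum (2 * h) + 4 * q - 2 + 2 * (2 * h + 1) * q : ZMod ((2 * h + 1) ^ 2)) * hπ
  have := (ZMod.intCast_eq_intCast_iff _ _ _).1 hfin
  exact_mod_cast this

end DelannoySchroder

theorem corollary1p1 :
    (∀ n : ℕ, 1 ≤ n →
      1 / (n : ℚ) * ∑ k ∈ Finset.range n,
          (DelannoySchroder.centralDelannoy k : ℚ) * DelannoySchroder.littleSchroder (k + 1) =
        ∑ k ∈ Finset.Icc 1 n, DelannoySchroder.w n k * (catalan (k - 1) : ℚ) * 2 ^ (k - 1) ∧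
      ∃ m : ℤ,
        ∑ k ∈ Finset.Icc 1 n, DelannoySchroder.w n k * (catalan (k - 1) : ℚ) * 2 ^ (k - 1) =
          (m : ℚ) ∧
        m ≡ 1 [ZMOD 2]) ∧
    (∀ p : ℕ, p.Prime → Odd p →
      ∃ S q : ℤ,
        ∑ k ∈ Finset.range p,
            (DelannoySchroder.centralDelannoy k : ℚ) * DelannoySchroder.littleSchroder (k + 1) =
          (S : ℚ) ∧
        DelannoySchroder.fermatQuotient p 2 = (q : ℚ) ∧
        S ≡ 2 * (p : ℤ) ^ 2 * (1 - 3 * q) [ZMOD (p : ℤ) ^ 3]) := by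
  refine ⟨fun n hn => ?_, fun p hp ho => ?_⟩
  · obtain ⟨n, rfl⟩ : ∃ m, n = m + 1 := ⟨n - 1, by omega⟩
    rw [DelannoySchroder.sum_centralDelannoy_eq_wSum, DelannoySchroder.sum_w_eq]
    refine ⟨?_, _, rfl, DelannoySchroder.wSum_odd n⟩
    have hn : (n : ℚ) + 1 ≠ 0 := by positivity
    push_cast
    field_simp
  · obtain ⟨h, rfl⟩ := ho
    have : Fact (2 * h + 1).Prime := ⟨hp⟩
    have two : IsCoprime (2 : ℤ) ((2 * h + 1 : ℕ) : ℤ) := ⟨-h, 1, by push_cast; ring⟩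
    have hdvd : ((2 * h + 1 : ℕ) : ℤ) ∣ 2 ^ (2 * h) - 1 :=
      (Int.ModEq.pow_card_sub_one_eq_one hp two).symm.dvd
    obtain ⟨q, hq⟩ := hdvd
    have hq' : (2 : ℤ) ^ (2 * h) = 1 + ((2 * h + 1 : ℕ) : ℤ) * q := by rw [← hq]; ring
    refine ⟨((2 * h + 1 : ℕ) : ℤ) * DelannoySchroder.wSum (2 * h), q, ?_, ?_, ?_⟩
    · rw [DelannoySchroder.sum_centralDelannoy_eq_wSum]
      push_cast
      ring
    · rw [DelannoySchroder.fermatQuotient, div_eq_iff (by positivity), Nat.add_sub_cancel]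
      have := congrArg (Int.cast (R := ℚ)) hq
      push_cast at this ⊢
      linear_combination this
    -- The sum is `p` times `wSum`, so a congruence modulo `p^2` suffices for one modulo `p^3`.
    · have := (DelannoySchroder.wSum_modEq hp hq').mul_left' (c := ((2 * h + 1 : ℕ) : ℤ))
      rw [← pow_succ'] at this
      convert this using 1
      ring
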